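/- Let $n\ge 1$, let $\mathcal F_n$ be the unital free semigroup (words) on $z_1,\dots,z_n$, and let $\mathcal H_n=\ell^2(\mathcal F_n)$ have orthonormal basis $\{\xi_w\}_{w\in\mathcal F_n}$. For $w\in\mathcal F_n$ let $L_w$ be the isometry on $\mathcal H_n$ with $L_w\xi_v=\xi_{wv}$ for every word $v$, and let $\mathfrak L_n$ be the unital algebra of bounded operators on $\mathcal H_n$, closed in the weak operator topology, that is generated by $L_{z_1},\dots,L_{z_n}$. An element $L\in\mathfrak L_n$ *properly factors* in $\mathfrak L_n$ if $L=BC$ with $B,C\in\mathfrak L_n$, neither of which is invertible in $\mathfrak L_n$. Let $L\in\mathfrak L_n$ be an isometry of the form $L=\sum_{|w|=k}L_wA_w$ for some $k\ge 1$ and some $A_w\in\mathfrak L_n$ ($|w|=k$). Suppose that one of the following holds: 1. for some word $w$ with $|w|=k$ there is a nonzero $B\in\mathfrak L_n$ whose range is orthogonal to the range of $A_w$; or 2. $n\ge 2$ and, for some word $w$ with $|w|=k$, $A_w$ is a scalar multiple of an isometry. Then $L$ properly factors in $\mathfrak L_n$. In particular, $L$ properly factors in $\mathfrak L_n$ if $A_w=0$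 for some $w$ with $|w|=k$. -/

import Mathlib

open scoped InnerProductSpace

noncomputable section

namespace FreeSemigroupAlgebra

/-- Words in `n` letters, decidably equal. -/
instance instDecidableEqWord (n : ℕ) : DecidableEq (FreeMonoid (Fin n)) := Classical.decEq _

/-- The Fock space `ℓ²(𝓕ₙ)` of square-summable complex functions on the unital free semigroup
`𝓕ₙ` on `n` generators. -/
abbrev Fock (n : ℕ) : Type := lp (fun _ : FreeMonoid (Fin n) => ℂ) 2

/-- The standard orthonormal basis vector `ξ_w` of the Fock space. -/
def xi {n : ℕ} (w : FreeMonoid (Fin n)) : Fock n := lp.single 2 w (1 : ℂ)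

theorem orthonormal_xi_mul {n : ℕ} (w : FreeMonoid (Fin n)) :
    Orthonormal ℂ (fun v : FreeMonoid (Fin n) => xi (w * v)) := by
  rw [orthonormal_iff_ite]
  intro u v
  rw [xi, xi, lp.inner_single_left, lp.single_apply]
  by_cases h : u = v
  · subst h; simp
  · have h' : w * u ≠ w * v := fun e => h (mul_left_cancel e)
    simp [h, h']

/-- The operator `L_w = λ(w)` of the left regular representation, as a linear isometry: the unique
bounded operator with `L_w ξ_v = ξ_{wv}`. -/
def leftRegIsometry {n : ℕ} (w : FreeMonoid (Fin n)) : Fock n →ₗᵢ[ℂ] Fock n :=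
  (orthonormal_xi_mul w).orthogonalFamily.linearIsometry

/-- The operator `L_w = λ(w)` on the Fock space. -/
def leftReg {n : ℕ} (w : FreeMonoid (Fin n)) : Fock n →L[ℂ] Fock n :=
  (leftRegIsometry w).toContinuousLinearMap

theorem leftReg_xi {n : ℕ} (w v : FreeMonoid (Fin n)) : leftReg w (xi v) = xi (w * v) := by
  change (orthonormal_xi_mul w).orthogonalFamily.linearIsometry (lp.single 2 v (1 : ℂ)) = _
  rw [OrthogonalFamily.linearIsometry_apply_single]
  simp

/-- A unital subalgebra of the bounded operators on a Hilbert space is closed in the weak operator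
topology. -/
def IsWOTClosed {H : Type*} [NormedAddCommGroup H] [InnerProductSpace ℂ H]
    (S : Subalgebra ℂ (H →L[ℂ] H)) : Prop :=
  IsClosed {T : H →WOT[ℂ] H | T.toCLM ∈ S}

/-- The non-commutative analytic Toeplitz algebra `𝔏ₙ`: the unital, weak-operator-closed algebra
generated by the isometries `L_i = λ(z_i)`, i.e. the smallest unital subalgebra of the bounded
operators on the Fock space that is closed in the weak operator topology and contains them. -/
def toeplitzAlgebra (n : ℕ) : Subalgebra ℂ (Fock n →L[ℂ] Fock n) :=
  sInf {S | IsWOTClosed S ∧ ∀ i : Fin n, leftReg (FreeMonoid.of i) ∈ S}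

/-- The finite set of words of length `k`. -/
def words (n k : ℕ) : Finset (FreeMonoid (Fin n)) :=
  Finset.univ.image fun s : Fin k → Fin n => FreeMonoid.ofList (List.ofFn s)

theorem mem_words {n k : ℕ} {w : FreeMonoid (Fin n)} : w ∈ words n k ↔ w.length = k := by
  simp only [words, Finset.mem_image, Finset.mem_univ, true_and]
  constructor
  · rintro ⟨s, rfl⟩
    exact List.length_ofFn
  · intro h
    subst h
    exact ⟨fun i => (FreeMonoid.toList w).get i, List.ofFn_get _⟩

/-- `L` properly factors in `𝔏ₙ`: it is a product of two elements of `𝔏ₙ`, neither of which is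
invertible in `𝔏ₙ`. -/
def ProperlyFactors {n : ℕ} (L : toeplitzAlgebra n) : Prop :=
  ∃ B C : toeplitzAlgebra n, L = B * C ∧ ¬ IsUnit B ∧ ¬ IsUnit C

end FreeSemigroupAlgebra

end

namespace FreeSemigroupAlgebra

open scoped ComplexConjugate
open Filter Topology

variable {n : ℕ}

/-! Everything reduces to one device. Suppose the algebra contains an isometry `X` with range
orthogonal to that of `L`, both ranges being orthogonal to the vacuum `ξ_1`. Put `u(z) = ∑ zᵐ/(m+1)`
and `g = 1/u`. Then `L = g(X) · u(X)L`. The ranges of the `XᵐL` are mutually orthogonal, so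
square-summable coefficients make `u(X)L` converge in norm. Kaluza's theorem makes the coefficients
of `g` absolutely summable, so `g(X)` converges too. Since `u(r) → ∞` as `r → 1`, the adjoint of
`g(X)` has eigenvalues `g(r)` tending to `0`, so `g(X)` is not invertible. Nor is `u(X)L`, whose
range misses the vacuum (`properlyFactors_of_orthogonal_isometry`).

It remains to find `X`. The ranges of the `L_w` with `|w| = k` are orthogonal, so `L_w* L = A_w`. If
the range of `B ≠ 0` is orthogonal to that of `A_w`, a Beurling-type argument gives an isometry `V`
of the algebra with range in the closure of that of `B` (`exists_isometry_of_ne_zero`), and `X = L_w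
V`. If `A_w` is a multiple of an isometry, `X` is a normalised combination of `L` and `L_w A_w`,
except in the extreme cases where some coefficient vanishes and `X` is a single `L_u`. That `V` lies
in the algebra is shown by Cesàro means of its Fourier series. -/

/-! ### Standard basis and the two regular representations -/

theorem inner_xi (w : FreeMonoid (Fin n)) (x : Fock n) : ⟪xi w, x⟫_ℂ = x w := by
  rw [xi, lp.inner_single_left]
  simp

theorem norm_xi (w : FreeMonoid (Fin n)) : ‖(xi w : Fock n)‖ = 1 := by
  simp [xi]

theorem xi_apply (w v : FreeMonoid (Fin n)) : (xi w : Fock n) v = if v = w then 1 else 0 := by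
  rw [xi, lp.single_apply]
  by_cases h : v = w
  · subst h; simp
  · simp [h]

theorem orthonormal_xi : Orthonormal ℂ (fun v : FreeMonoid (Fin n) => (xi v : Fock n)) := by
  simpa using orthonormal_xi_mul (1 : FreeMonoid (Fin n))

theorem hasSum_smul_xi (x : Fock n) : HasSum (fun v => x v • (xi v : Fock n)) x := by
  have h := lp.hasSum_single (p := 2) (by simp) x
  convert h using 2 with v
  rw [xi, ← lp.single_smul]
  simp

theorem clm_ext_xi {E : Type*} [NormedAddCommGroup E] [NormedSpace ℂ E] {S T : Fock n →L[ℂ] E}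
    (h : ∀ v, S (xi v) = T (xi v)) : S = T := by
  ext x
  have hS := (hasSum_smul_xi x).mapL S
  have hT := (hasSum_smul_xi x).mapL T
  refine hS.unique ?_
  convert hT using 2 with v
  simp [h]

/-- The linear isometry sending the standard basis to a given orthonormal family. -/
noncomputable def isometryOfOrthonormal {b : FreeMonoid (Fin n) → Fock n} (hb : Orthonormal ℂ b) :
    Fock n →ₗᵢ[ℂ] Fock n :=
  hb.orthogonalFamily.linearIsometry

theorem isometryOfOrthonormal_xi {b : FreeMonoid (Fin n) → Fock n} (hb : Orthonormal ℂ b)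
    (v : FreeMonoid (Fin n)) : isometryOfOrthonormal hb (xi v) = b v := by
  change hb.orthogonalFamily.linearIsometry (lp.single 2 v (1 : ℂ)) = _
  rw [OrthogonalFamily.linearIsometry_apply_single]
  simp

theorem orthonormal_xi_mul_right (v : FreeMonoid (Fin n)) :
    Orthonormal ℂ (fun u : FreeMonoid (Fin n) => (xi (u * v) : Fock n)) :=
  orthonormal_xi.comp (fun u => u * v) fun _ _ h => mul_right_cancel h

/-- The operator `R_v` of the right regular representation: `R_v ξ_u = ξ_{uv}`. -/
noncomputable def rightReg (v : FreeMonoid (Fin n)) : Fock n →L[ℂ] Fock n :=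
  (isometryOfOrthonormal (orthonormal_xi_mul_right v)).toContinuousLinearMap

theorem rightReg_xi (v u : FreeMonoid (Fin n)) : rightReg v (xi u) = (xi (u * v) : Fock n) :=
  isometryOfOrthonormal_xi (orthonormal_xi_mul_right v) u

theorem inner_rightReg_rightReg (v : FreeMonoid (Fin n)) (x y : Fock n) :
    ⟪rightReg v x, rightReg v y⟫_ℂ = ⟪x, y⟫_ℂ :=
  (isometryOfOrthonormal (orthonormal_xi_mul_right v)).inner_map_map x y

theorem rightReg_mul (v u : FreeMonoid (Fin n)) :
    (rightReg (u * v) : Fock n →L[ℂ] Fock n) = rightReg v * rightReg u :=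
  clm_ext_xi fun x => by simp [rightReg_xi, mul_assoc]

theorem rightReg_apply_mul (v u : FreeMonoid (Fin n)) (x : Fock n) :
    rightReg v x (u * v) = x u := by
  rw [← inner_xi, ← inner_xi, ← rightReg_xi, inner_rightReg_rightReg]

theorem rightReg_apply_of_forall_ne {v w : FreeMonoid (Fin n)} (h : ∀ u, u * v ≠ w) (x : Fock n) :
    rightReg v x w = 0 := by
  have : (innerSL ℂ (xi w)).comp (rightReg v) = 0 := clm_ext_xi fun u => by
    simp only [ContinuousLinearMap.comp_apply, innerSL_apply_apply, rightReg_xi, inner_xi, xi_apply,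
      zero_apply]
    rw [if_neg (h u).symm]
  have := DFunLike.congr_fun this x
  simpa [inner_xi] using this

theorem inner_leftReg_leftReg (w : FreeMonoid (Fin n)) (x y : Fock n) :
    ⟪leftReg w x, leftReg w y⟫_ℂ = ⟪x, y⟫_ℂ :=
  (leftRegIsometry w).inner_map_map x y

theorem leftReg_mul (w v : FreeMonoid (Fin n)) :
    (leftReg (w * v) : Fock n →L[ℂ] Fock n) = leftReg w * leftReg v :=
  clm_ext_xi fun x => by simp [leftReg_xi, mul_assoc]

theorem leftReg_one : (leftReg 1 : Fock n →L[ℂ] Fock n) = 1 :=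
  clm_ext_xi fun x => by simp [leftReg_xi]

theorem leftReg_apply_of_forall_ne {v w : FreeMonoid (Fin n)} (h : ∀ u, v * u ≠ w) (x : Fock n) :
    leftReg v x w = 0 := by
  have : (innerSL ℂ (xi w)).comp (leftReg v) = 0 := clm_ext_xi fun u => by
    simp only [ContinuousLinearMap.comp_apply, innerSL_apply_apply, leftReg_xi, inner_xi, xi_apply,
      zero_apply]
    rw [if_neg (h u).symm]
  have := DFunLike.congr_fun this x
  simpa [inner_xi] using this

/-- Left creation operators for different words of the same length have orthogonal ranges. -/
theorem inner_leftReg_leftReg_of_ne {w v : FreeMonoid (Fin n)} (hl : w.length = v.length)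
    (hne : w ≠ v) (x y : Fock n) : ⟪leftReg w x, leftReg v y⟫_ℂ = 0 := by
  have key : ∀ u, ⟪xi (w * u), leftReg v y⟫_ℂ = 0 := fun u => by
    rw [inner_xi]
    refine leftReg_apply_of_forall_ne (fun t ht => hne ?_) y
    have h : v.toList ++ t.toList = w.toList ++ u.toList := congrArg FreeMonoid.toList ht
    exact (FreeMonoid.toList.injective (List.append_inj_left h hl.symm)).symm
  have : (innerSL ℂ (leftReg v y)).comp (leftReg w) = 0 := clm_ext_xi fun u => by
    simp only [ContinuousLinearMap.comp_apply, innerSL_apply_apply, leftReg_xi,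
      zero_apply]
    rw [← inner_conj_symm, key, map_zero]
  rw [← inner_conj_symm]
  have := DFunLike.congr_fun this x
  simp only [ContinuousLinearMap.comp_apply, innerSL_apply_apply,
      zero_apply] at this
  rw [this, map_zero]

/-- The vacuum vector is orthogonal to the range of a creation operator. -/
theorem inner_xi_one_leftReg {w : FreeMonoid (Fin n)} (hw : w ≠ 1) (x : Fock n) :
    ⟪xi 1, leftReg w x⟫_ℂ = 0 := by
  rw [inner_xi]
  refine leftReg_apply_of_forall_ne (fun u hu => hw ?_) x
  exact List.append_eq_nil_iff.1 hu |>.1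

/-! ### Weak operator limits and the commutant of the algebra -/

theorem leftReg_mem (w : FreeMonoid (Fin n)) : leftReg w ∈ toeplitzAlgebra n := by
  induction w using FreeMonoid.inductionOn' with
  | one => rw [leftReg_one]; exact one_mem _
  | of_mul i w ih =>
    rw [leftReg_mul]
    refine mul_mem ?_ ih
    rw [toeplitzAlgebra, Algebra.mem_sInf]
    exact fun S hS => hS.2 i

/-- The free semigroup algebra is closed under limits in the weak operator topology. -/
theorem mem_toeplitzAlgebra_of_tendsto_inner {ι : Type*} {l : Filter ι} [l.NeBot]
    {S : ι → Fock n →L[ℂ] Fock n} {T : Fock n →L[ℂ] Fock n} (hS : ∀ i, S i ∈ toeplitzAlgebra n)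
    (h : ∀ x y, Tendsto (fun i => ⟪y, S i x⟫_ℂ) l (𝓝 ⟪y, T x⟫_ℂ)) : T ∈ toeplitzAlgebra n := by
  rw [toeplitzAlgebra, Algebra.mem_sInf]
  intro A hA
  have hcl : IsClosed {T : Fock n →WOT[ℂ] Fock n | T.toCLM ∈ A} := hA.1
  have : Tendsto (fun i => ContinuousLinearMapWOT.ofCLM (S i)) l
      (𝓝 (ContinuousLinearMapWOT.ofCLM T)) :=
    ContinuousLinearMapWOT.tendsto_iff_forall_inner_apply_tendsto.2 h
  refine hcl.mem_of_tendsto this (Eventually.of_forall fun i => ?_)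
  have := hS i
  rw [toeplitzAlgebra, Algebra.mem_sInf] at this
  exact this A hA

theorem mem_toeplitzAlgebra_of_hasSum {ι : Type*} {S : ι → Fock n →L[ℂ] Fock n}
    {T : Fock n →L[ℂ] Fock n} (hS : ∀ i, S i ∈ toeplitzAlgebra n) (h : HasSum S T) :
    T ∈ toeplitzAlgebra n := by
  refine mem_toeplitzAlgebra_of_tendsto_inner (l := atTop) (S := fun s : Finset ι => ∑ i ∈ s, S i)
    (fun s => sum_mem fun i _ => hS i) fun x y => tendsto_const_nhds.inner ?_
  exact ((ContinuousLinearMap.apply ℂ (Fock n) x).continuous.tendsto T).comp h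

/-- Elements of the free semigroup algebra commute with the right regular representation. -/
theorem commute_rightReg {T : Fock n →L[ℂ] Fock n} (hT : T ∈ toeplitzAlgebra n)
    (v : FreeMonoid (Fin n)) : T * rightReg v = rightReg v * T := by
  rw [toeplitzAlgebra, Algebra.mem_sInf] at hT
  suffices T ∈ Subalgebra.centralizer ℂ {(rightReg v : Fock n →L[ℂ] Fock n)} from
    ((Subalgebra.mem_centralizer_iff ℂ).1 this _ rfl).symm
  refine hT _ ⟨?_, fun i => ?_⟩
  -- Moving `R_v` across by its adjoint expresses commutation as equalities between matrix
  -- coefficients, each a closed condition in the weak operator topology.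
  · have : {T : Fock n →WOT[ℂ] Fock n |
        T.toCLM ∈ Subalgebra.centralizer ℂ {(rightReg v : Fock n →L[ℂ] Fock n)}} =
        ⋂ (x) (y), {T : Fock n →WOT[ℂ] Fock n |
          ⟪ContinuousLinearMap.adjoint (rightReg v) y, T x⟫_ℂ = ⟪y, T (rightReg v x)⟫_ℂ} := by
      ext T
      simp only [Set.mem_ofPred_eq, Subalgebra.mem_centralizer_iff, Set.mem_singleton_iff,
        forall_eq, Set.mem_iInter, ContinuousLinearMap.adjoint_inner_left]
      constructor
      · intro h x y
        have := DFunLike.congr_fun h x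
        exact congrArg (fun z => ⟪y, z⟫_ℂ) this
      · intro h
        ext1 x
        exact ext_inner_left ℂ fun y => h x y
    unfold IsWOTClosed
    rw [this]
    have hc := ContinuousLinearMapWOT.continuous_iff.1
      (continuous_id : Continuous (id : (Fock n →WOT[ℂ] Fock n) → Fock n →WOT[ℂ] Fock n))
    exact isClosed_iInter fun x => isClosed_iInter fun y => isClosed_eq (hc _ _) (hc _ _)
  · rw [Subalgebra.mem_centralizer_iff]
    rintro _ rfl
    exact clm_ext_xi fun u => by simp [rightReg_xi, leftReg_xi, mul_assoc]

section Reciprocal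

/-! ### The reciprocal of the series `∑ zᵐ / (m + 1)` -/

/-- The coefficients of the reciprocal of the power series `∑ zᵐ / (m + 1)`. -/
noncomputable def recipCoeff (m : ℕ) : ℝ :=
  PowerSeries.coeff m (PowerSeries.mk fun m : ℕ => (1 : ℝ) / (m + 1))⁻¹

theorem sum_antidiagonal_recipCoeff (m : ℕ) :
    ∑ p ∈ Finset.HasAntidiagonal.antidiagonal m, recipCoeff p.1 * (1 / ((p.2 : ℝ) + 1)) =
      if m = 0 then 1 else 0 := by
  have h := PowerSeries.inv_mul_cancel (PowerSeries.mk fun m : ℕ => (1 : ℝ) / (m + 1))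
    (by simp [← PowerSeries.coeff_zero_eq_constantCoeff_apply])
  have h := congrArg (PowerSeries.coeff m) h
  rw [PowerSeries.coeff_mul, PowerSeries.coeff_one] at h
  simpa only [PowerSeries.coeff_mk, recipCoeff] using h

theorem sum_range_recipCoeff (m : ℕ) :
    ∑ j ∈ Finset.range (m + 1), recipCoeff j * (1 / (((m - j : ℕ) : ℝ) + 1)) =
      if m = 0 then 1 else 0 := by
  rw [← sum_antidiagonal_recipCoeff, Finset.Nat.sum_antidiagonal_eq_sum_range_succ_mk]

theorem recipCoeff_zero : recipCoeff 0 = 1 := by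
  simpa using sum_range_recipCoeff 0

theorem sum_recipCoeff_succ {m : ℕ} (hm : m ≠ 0) :
    ∑ j ∈ Finset.range m, recipCoeff (j + 1) * (1 / ((m : ℝ) - j)) = -(1 / ((m : ℝ) + 1)) := by
  have h := sum_range_recipCoeff m
  rw [Finset.sum_range_succ', recipCoeff_zero, if_neg hm] at h
  rw [eq_neg_iff_add_eq_zero, ← h]
  congr 1
  · refine Finset.sum_congr rfl fun j hj => ?_
    rw [Finset.mem_range] at hj
    rw [Nat.cast_sub hj]
    push_cast
    congr 3
    ring
  · simp

/-- Kaluza's theorem for the log-convex sequence `1 / (m + 1)`. -/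
theorem recipCoeff_succ_nonpos (m : ℕ) : recipCoeff (m + 1) ≤ 0 := by
  induction m using Nat.strong_induction_on with
  | _ m ih =>
    have h1 := sum_recipCoeff_succ m.succ_ne_zero
    rw [Finset.sum_range_succ] at h1
    push_cast at h1
    rcases eq_or_ne m 0 with rfl | hm
    · norm_num at h1 ⊢
      linarith
    have h0 := sum_recipCoeff_succ hm
    have hmR : (0 : ℝ) < m := by positivity
    -- Subtract `(m+1)/(m+2)` times the identity at `m` from the one at `m + 1`: the right-hand
    -- sides cancel and the new coefficient is minus this sum. Log-convexity makes each weight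
    -- nonpositive.
    have h2 : 0 ≤ ∑ j ∈ Finset.range m, (recipCoeff (j + 1) * (1 / ((m : ℝ) + 1 - j)) -
        (m + 1) / (m + 2) * (recipCoeff (j + 1) * (1 / ((m : ℝ) - j)))) := by
      refine Finset.sum_nonneg fun j hj => ?_
      rw [Finset.mem_range] at hj
      have hj' : (0 : ℝ) < m - j := by rw [sub_pos]; exact_mod_cast hj
      have h3 : 1 / ((m : ℝ) + 1 - j) - (m + 1) / (m + 2) * (1 / ((m : ℝ) - j)) ≤ 0 := by
        rw [sub_nonpos, div_mul_div_comm, div_le_div_iff₀ (by linarith) (by positivity)]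
        have : (0 : ℝ) ≤ j := by positivity
        nlinarith
      have := mul_nonneg_of_nonpos_of_nonpos (ih j hj) h3
      linarith
    rw [Finset.sum_sub_distrib, ← Finset.mul_sum, h0] at h2
    have h4 : ((m : ℝ) + 1) / (m + 2) * -(1 / (m + 1)) = -(1 / (m + 1 + 1)) := by
      field_simp
      ring
    rw [h4] at h2
    have h5 : (m : ℝ) + 1 - m = 1 := by ring
    rw [h5] at h1
    linarith

/-- Past index `0` all coefficients are nonpositive, so nothing cancels in `sum_recipCoeff_succ`.
Its weights are at least `1/m`, which bounds the partial sums by `m/(m+1)`. -/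
theorem summable_abs_recipCoeff : Summable fun m => |recipCoeff m| := by
  rw [← summable_nat_add_iff 1]
  refine summable_of_sum_range_le (c := 1) (fun _ => abs_nonneg _) fun m => ?_
  rcases eq_or_ne m 0 with rfl | hm
  · simp
  have hmR : (0 : ℝ) < m := by positivity
  have h := sum_recipCoeff_succ hm
  have h2 : ∑ j ∈ Finset.range m, |recipCoeff (j + 1)| * (1 / m) ≤ 1 / ((m : ℝ) + 1) := by
    rw [← neg_eq_iff_eq_neg] at h
    rw [← h, ← Finset.sum_neg_distrib]
    refine Finset.sum_le_sum fun j hj => ?_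
    rw [Finset.mem_range] at hj
    have hj' : (0 : ℝ) < m - j := by rw [sub_pos]; exact_mod_cast hj
    rw [← neg_mul, abs_of_nonpos (recipCoeff_succ_nonpos j)]
    refine mul_le_mul_of_nonneg_left (one_div_le_one_div_of_le hj' ?_)
      (neg_nonneg.2 (recipCoeff_succ_nonpos j))
    linarith [(Nat.cast_nonneg j : (0 : ℝ) ≤ j)]
  rw [← Finset.sum_mul, mul_one_div, div_le_div_iff₀ hmR (by positivity)] at h2
  nlinarith

theorem summable_inv_succ_sq : Summable fun m : ℕ => ((1 : ℝ) / (m + 1)) ^ 2 := by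
  have h := (summable_nat_add_iff 1).2 (Real.summable_one_div_nat_pow.2 one_lt_two)
  simpa [div_pow] using h

/-- The reciprocal power series takes arbitrarily small values on `(0, 1)`. -/
theorem exists_abs_tsum_recipCoeff_lt {K : ℝ} (hK : 0 < K) :
    ∃ r : ℝ, 0 < r ∧ r < 1 ∧ |∑' m, recipCoeff m * r ^ m| * K < 1 := by
  -- The harmonic series diverges, so some partial sum exceeds `K` at `r = 1`, hence also for `r <
  -- 1` close to `1`. The reciprocal series is then below `1/K`.
  obtain ⟨N, hN⟩ := (Real.tendsto_sum_range_one_div_nat_succ_atTop.eventually_gt_atTop K).exists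
  have hcont : Continuous fun r : ℝ => ∑ m ∈ Finset.range N, 1 / ((m : ℝ) + 1) * r ^ m := by
    fun_prop
  have hev : ∀ᶠ r in 𝓝[<] (1 : ℝ), K < ∑ m ∈ Finset.range N, 1 / ((m : ℝ) + 1) * r ^ m := by
    refine (hcont.tendsto 1).mono_left nhdsWithin_le_nhds |>.eventually_const_lt ?_
    simpa using hN
  obtain ⟨r, hr, hr0, hr1⟩ := (hev.and (Ioo_mem_nhdsLT (zero_lt_one' ℝ))).exists
  refine ⟨r, hr0, hr1, ?_⟩
  have hu : Summable fun m : ℕ => 1 / ((m : ℝ) + 1) * r ^ m := by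
    refine Summable.of_nonneg_of_le (fun m => by positivity) (fun m => ?_)
      (summable_geometric_of_lt_one hr0.le hr1)
    refine mul_le_of_le_one_left (by positivity) ?_
    rw [div_le_one (by positivity)]
    linarith [(Nat.cast_nonneg m : (0 : ℝ) ≤ m)]
  have hg : Summable fun m : ℕ => ‖recipCoeff m * r ^ m‖ := by
    refine Summable.of_nonneg_of_le (fun m => norm_nonneg _) (fun m => ?_) summable_abs_recipCoeff
    rw [norm_mul, Real.norm_eq_abs, norm_pow, Real.norm_of_nonneg hr0.le]
    exact mul_le_of_le_one_right (abs_nonneg _) (pow_le_one₀ hr0.le hr1.le)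
  have hprod := tsum_mul_tsum_eq_tsum_sum_antidiagonal_of_summable_norm hg hu.norm
  have hone : ∑' m, ∑ p ∈ Finset.HasAntidiagonal.antidiagonal m,
      recipCoeff p.1 * r ^ p.1 * (1 / ((p.2 : ℝ) + 1) * r ^ p.2) = 1 := by
    rw [tsum_eq_single 0]
    · simp [recipCoeff_zero]
    · intro m hm
      have : ∀ p ∈ Finset.HasAntidiagonal.antidiagonal m,
          recipCoeff p.1 * r ^ p.1 * (1 / ((p.2 : ℝ) + 1) * r ^ p.2) =
          r ^ m * (recipCoeff p.1 * (1 / ((p.2 : ℝ) + 1))) := fun p hp => by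
        rw [← Finset.HasAntidiagonal.mem_antidiagonal.1 hp, pow_add]
        ring
      rw [Finset.sum_congr rfl this, ← Finset.mul_sum, sum_antidiagonal_recipCoeff, if_neg hm,
        mul_zero]
  rw [hone] at hprod
  have hlt : K < ∑' m : ℕ, 1 / ((m : ℝ) + 1) * r ^ m :=
    hr.trans_le (hu.sum_le_tsum _ fun m _ => by positivity)
  set U := ∑' m : ℕ, 1 / ((m : ℝ) + 1) * r ^ m
  have hU : 0 < U := hK.trans hlt
  have hG : ∑' m, recipCoeff m * r ^ m = 1 / U := by
    rw [eq_div_iff hU.ne', hprod]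
  rw [hG, abs_of_pos (by positivity), one_div_mul_eq_div, div_lt_one hU]
  exact hlt

end Reciprocal

/-! ### Operator series in an isometry -/

section Hilbert

variable {H : Type*} [NormedAddCommGroup H] [InnerProductSpace ℂ H] {X L : H →L[ℂ] H}

theorem norm_map_of_inner_map_map (hX : ∀ x y, ⟪X x, X y⟫_ℂ = ⟪x, y⟫_ℂ) (x : H) :
    ‖X x‖ = ‖x‖ := by
  rw [@norm_eq_sqrt_re_inner ℂ, @norm_eq_sqrt_re_inner ℂ _ _ _ _ x, hX]

theorem inner_map_map_of_isometry (hX : Isometry X) (x y : H) : ⟪X x, X y⟫_ℂ = ⟪x, y⟫_ℂ :=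
  (LinearIsometry.mk X.toLinearMap fun x => by
    simpa using hX.dist_eq x 0).inner_map_map x y

theorem inner_pow_pow (hX : ∀ x y, ⟪X x, X y⟫_ℂ = ⟪x, y⟫_ℂ) (m : ℕ) (x y : H) :
    ⟪(X ^ m) x, (X ^ m) y⟫_ℂ = ⟪x, y⟫_ℂ := by
  induction m with
  | zero => simp
  | succ m ih => rw [pow_succ', mul_apply_eq_comp, mul_apply_eq_comp, hX, ih]

theorem inner_pow_of_lt (hX : ∀ x y, ⟪X x, X y⟫_ℂ = ⟪x, y⟫_ℂ)
    (hXL : ∀ x y, ⟪X x, L y⟫_ℂ = 0) {i j : ℕ} (h : i < j) (x y : H) :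
    ⟪(X ^ i) (L x), (X ^ j) y⟫_ℂ = 0 := by
  obtain ⟨k, rfl⟩ := Nat.exists_eq_add_of_lt h
  rw [add_assoc, pow_add, mul_apply_eq_comp, inner_pow_pow hX, pow_succ', mul_apply_eq_comp,
    ← inner_conj_symm, hXL, map_zero]

theorem inner_pow_of_ne (hX : ∀ x y, ⟪X x, X y⟫_ℂ = ⟪x, y⟫_ℂ)
    (hXL : ∀ x y, ⟪X x, L y⟫_ℂ = 0) {i j : ℕ} (h : i ≠ j) (x y : H) :
    ⟪(X ^ i) (L x), (X ^ j) (L y)⟫_ℂ = 0 := by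
  rcases lt_or_gt_of_ne h with h | h
  · exact inner_pow_of_lt hX hXL h x _
  · rw [← inner_conj_symm, inner_pow_of_lt hX hXL h y, map_zero]

theorem norm_sum_smul_pow_sq (hX : ∀ x y, ⟪X x, X y⟫_ℂ = ⟪x, y⟫_ℂ)
    (hL : ∀ x y, ⟪L x, L y⟫_ℂ = ⟪x, y⟫_ℂ) (hXL : ∀ x y, ⟪X x, L y⟫_ℂ = 0) (c : ℕ → ℂ)
    (s : Finset ℕ) (x : H) :
    ‖∑ m ∈ s, c m • (X ^ m) (L x)‖ ^ 2 = (∑ m ∈ s, ‖c m‖ ^ 2) * ‖x‖ ^ 2 := by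
  have hV : OrthogonalFamily ℂ (fun _ : ℕ => H) fun m : ℕ =>
      (LinearIsometry.mk (X ^ m * L).toLinearMap fun x => by
        exact (norm_map_of_inner_map_map (inner_pow_pow hX m) (L x)).trans
          (norm_map_of_inner_map_map hL x) : H →ₗᵢ[ℂ] H) :=
    fun i j hij x y => inner_pow_of_ne hX hXL hij x y
  have := hV.norm_sum (fun m => c m • x) s
  simp only [norm_smul, mul_pow, ← Finset.sum_mul, map_smul] at this
  exact this

/-- By Pythagoras a finite block of the series has norm at most the `ℓ²` norm of its coefficients,
so absolute summability is not needed. -/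
theorem summable_smul_pow_mul [CompleteSpace H] (hX : ∀ x y, ⟪X x, X y⟫_ℂ = ⟪x, y⟫_ℂ)
    (hL : ∀ x y, ⟪L x, L y⟫_ℂ = ⟪x, y⟫_ℂ) (hXL : ∀ x y, ⟪X x, L y⟫_ℂ = 0) {c : ℕ → ℂ}
    (hc : Summable fun m => ‖c m‖ ^ 2) : Summable fun m => c m • (X ^ m * L) := by
  rw [summable_iff_vanishing_norm]
  intro ε hε
  obtain ⟨s, hs⟩ := summable_iff_vanishing_norm.1 hc ((ε / 2) ^ 2) (by positivity)
  refine ⟨s, fun t ht => lt_of_le_of_lt ?_ (half_lt_self hε)⟩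
  refine ContinuousLinearMap.opNorm_le_bound _ (by positivity) fun x => ?_
  refine (sq_le_sq₀ (norm_nonneg _) (by positivity)).1 ?_
  have h1 := (le_abs_self _).trans_lt (hs t ht)
  have h2 := norm_sum_smul_pow_sq hX hL hXL c t x
  rw [mul_pow, sum_apply]
  simp only [smul_apply, mul_apply_eq_comp]
  rw [h2]
  gcongr

theorem norm_pow_le_one (hX : ∀ x y, ⟪X x, X y⟫_ℂ = ⟪x, y⟫_ℂ) (m : ℕ) : ‖X ^ m‖ ≤ 1 :=
  ContinuousLinearMap.opNorm_le_bound _ zero_le_one fun x => by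
    rw [norm_map_of_inner_map_map (inner_pow_pow hX m), one_mul]

theorem summable_smul_pow [CompleteSpace H] (hX : ∀ x y, ⟪X x, X y⟫_ℂ = ⟪x, y⟫_ℂ) {g : ℕ → ℂ}
    (hg : Summable fun m => ‖g m‖) : Summable fun m => g m • X ^ m := by
  refine Summable.of_norm_bounded hg fun m => ?_
  rw [norm_smul]
  exact mul_le_of_le_one_right (norm_nonneg _) (norm_pow_le_one hX m)

/-- If `∑ g_m zᵐ` and `∑ c_m zᵐ` are reciprocal power series, the operator series
`∑ g_m Xᵐ` and `∑ c_m Xᵐ L` multiply to `L`. -/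
theorem mul_eq_of_hasSum (hX : ∀ x y, ⟪X x, X y⟫_ℂ = ⟪x, y⟫_ℂ)
    (hXL : ∀ x y, ⟪X x, L y⟫_ℂ = 0) {g c : ℕ → ℂ}
    (hgc : ∀ m, ∑ j ∈ Finset.range (m + 1), g j * c (m - j) = if m = 0 then 1 else 0)
    {F C : H →L[ℂ] H} (hF : HasSum (fun m => g m • X ^ m) F)
    (hC : HasSum (fun m => c m • (X ^ m * L)) C) : F * C = L := by
  ext1 x
  have hFy : ∀ y, HasSum (fun m => g m • (X ^ m) y) (F y) := fun y =>
    hF.mapL (ContinuousLinearMap.apply ℂ H y)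
  have hCx : HasSum (fun m => c m • (X ^ m) (L x)) (C x) :=
    hC.mapL (ContinuousLinearMap.apply ℂ H x)
  have hXC : ∀ j, HasSum (fun m => c m • (X ^ (j + m)) (L x)) ((X ^ j) (C x)) := fun j => by
    simpa [pow_add] using hCx.mapL (X ^ j)
  -- The error `F C x - L x` is tested against each `Xⁱ L x`, where only finitely many terms survive
  -- and form a Cauchy product. This avoids rearranging a double series in which `c` need not be
  -- absolutely summable.
  have horth : ∀ i, ⟪(X ^ i) (L x), F (C x) - L x⟫_ℂ = 0 := fun i => by
    have h1 : ∀ j, ⟪(X ^ i) (L x), (X ^ j) (C x)⟫_ℂ =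
        if j ≤ i then c (i - j) * ⟪L x, L x⟫_ℂ else 0 := fun j => by
      have h := (hXC j).mapL (innerSL ℂ ((X ^ i) (L x)))
      simp only [innerSL_apply_apply, inner_smul_right] at h
      refine h.unique ?_
      split_ifs with hji
      · have := hasSum_single (L := .unconditional ℕ)
          (f := fun m => c m * ⟪(X ^ i) (L x), (X ^ (j + m)) (L x)⟫_ℂ)
          (i - j) fun m hm => by
            rw [inner_pow_of_ne hX hXL (by omega), mul_zero]
        rwa [Nat.add_sub_cancel' hji, inner_pow_pow hX] at this
      · convert hasSum_zero using 2 with m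
        rw [inner_pow_of_ne hX hXL (by omega), mul_zero]
    have h2 := (hFy (C x)).mapL (innerSL ℂ ((X ^ i) (L x)))
    simp only [innerSL_apply_apply, inner_smul_right, h1] at h2
    have h3 := hasSum_sum_of_ne_finset_zero (L := .unconditional ℕ)
      (f := fun j => g j * if j ≤ i then c (i - j) * ⟪L x, L x⟫_ℂ else 0)
      (s := Finset.range (i + 1)) fun j hj => by
        rw [Finset.mem_range, not_lt] at hj
        rw [if_neg (by omega), mul_zero]
    rw [inner_sub_right, h2.unique h3]
    have h4 : ∑ j ∈ Finset.range (i + 1), (g j * if j ≤ i then c (i - j) * ⟪L x, L x⟫_ℂ else 0) =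
        (if i = 0 then 1 else 0) * ⟪L x, L x⟫_ℂ := by
      rw [← hgc, Finset.sum_mul]
      refine Finset.sum_congr rfl fun j hj => ?_
      rw [Finset.mem_range] at hj
      rw [if_pos (by omega), mul_assoc]
    rw [h4, sub_eq_zero]
    rcases eq_or_ne i 0 with rfl | hi
    · simp
    · rw [if_neg hi, zero_mul, ← inner_conj_symm,
        show L x = (X ^ 0) (L x) by simp, inner_pow_of_lt hX hXL (Nat.pos_of_ne_zero hi),
        map_zero]
  set E := F (C x) - L x with hE
  have horth' : ∀ i, ⟪E, (X ^ i) (L x)⟫_ℂ = 0 := fun i => by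
    rw [← inner_conj_symm, horth, map_zero]
  -- The error also lies in the closed span of the vectors `Xⁱ L x`, so it is orthogonal to itself.
  have h5 : ∀ j, ⟪E, (X ^ j) (C x)⟫_ℂ = 0 := fun j => by
    have h := (hXC j).mapL (innerSL ℂ E)
    simp only [innerSL_apply_apply, inner_smul_right, horth', mul_zero] at h
    exact h.unique hasSum_zero
  have h6 : ⟪E, F (C x)⟫_ℂ = 0 := by
    have h := (hFy (C x)).mapL (innerSL ℂ E)
    simp only [innerSL_apply_apply, inner_smul_right, h5, mul_zero] at h
    exact h.unique hasSum_zero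
  have h7 : ⟪E, E⟫_ℂ = 0 := by
    conv_lhs => rw [hE, inner_sub_right, ← hE, h6, show L x = (X ^ 0) (L x) by simp, horth']
    simp
  rw [mul_apply_eq_comp, ← sub_eq_zero, ← hE]
  exact inner_self_eq_zero.1 h7

/-- For an isometry `X` whose range is orthogonal to a nonzero vector, `∑ g_m Xᵐ` has no right
inverse when `∑ g_m rᵐ` takes arbitrarily small values on `(0, 1)`. -/
theorem not_exists_mul_eq_one [CompleteSpace H] (hX : ∀ x y, ⟪X x, X y⟫_ℂ = ⟪x, y⟫_ℂ) {e : H}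
    (he : e ≠ 0) (heX : ∀ x, ⟪e, X x⟫_ℂ = 0) {g : ℕ → ℝ}
    (hg : ∀ K : ℝ, 0 < K → ∃ r : ℝ, 0 < r ∧ r < 1 ∧ |∑' m, g m * r ^ m| * K < 1)
    {F D : H →L[ℂ] H} (hF : HasSum (fun m => (g m : ℂ) • X ^ m) F) : F * D ≠ 1 := by
  intro hFD
  obtain ⟨r, hr0, hr1, hr⟩ := hg (‖D‖ + 1) (by positivity)
  have hnorm : ‖(r : ℂ) • X‖ < 1 := by
    rw [norm_smul, Complex.norm_real, Real.norm_of_nonneg hr0.le]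
    have := norm_pow_le_one hX 1
    rw [pow_one] at this
    nlinarith [norm_nonneg X]
  -- The vector `y = (1 - rX)⁻¹ e` is an eigenvector of `X*` with eigenvalue `r`, because `X* e =
  -- 0`.
  obtain ⟨y, hy⟩ : ∃ y : H, y - (r : ℂ) • X y = e := by
    refine ⟨(((Units.oneSub _ hnorm)⁻¹ : (H →L[ℂ] H)ˣ) : H →L[ℂ] H) e, ?_⟩
    have := DFunLike.congr_fun (Units.oneSub _ hnorm).mul_inv e
    simpa [Units.val_oneSub] using this
  have hy' : y = e + (r : ℂ) • X y := by rw [← hy]; abel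
  have hy0 : y ≠ 0 := by
    rintro rfl
    exact he (by simpa using hy'.symm)
  have h1 : ∀ x, ⟪y, X x⟫_ℂ = r * ⟪y, x⟫_ℂ := fun x => by
    conv_lhs => rw [hy']
    rw [inner_add_left, heX, inner_smul_left, hX, zero_add, Complex.conj_ofReal]
  have h2 : ∀ m x, ⟪y, (X ^ m) x⟫_ℂ = (r : ℂ) ^ m * ⟪y, x⟫_ℂ := fun m x => by
    induction m with
    | zero => simp
    | succ m ih => rw [pow_succ', mul_apply_eq_comp, h1, ih, pow_succ']; ring
  have h3 : ∀ x, ⟪y, F x⟫_ℂ = ((∑' m, g m * r ^ m : ℝ) : ℂ) * ⟪y, x⟫_ℂ := fun x => by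
    have h := (hF.mapL (ContinuousLinearMap.apply ℂ H x)).mapL (innerSL ℂ y)
    simp only [ContinuousLinearMap.apply_apply, smul_apply,
      innerSL_apply_apply, inner_smul_right, h2] at h
    rw [← h.tsum_eq, Complex.ofReal_tsum, ← tsum_mul_right]
    refine tsum_congr fun m => ?_
    push_cast
    ring
  have h4 := h3 (D y)
  rw [← mul_apply_eq_comp, hFD, one_apply_eq_self] at h4
  -- A right inverse `D` would give `‖y‖² = g(r) ⟪y, D y⟫`, contradicting `|g(r)| (‖D‖ + 1) < 1`.
  have h5 : ‖y‖ ^ 2 ≤ |∑' m, g m * r ^ m| * (‖D‖ * ‖y‖ ^ 2) := by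
    have := congrArg norm h4
    rw [norm_mul, Complex.norm_real, Real.norm_eq_abs, inner_self_eq_norm_sq_to_K] at this
    simp only [Complex.coe_algebraMap, norm_pow, Complex.norm_real, norm_norm] at this
    refine this.le.trans (mul_le_mul_of_nonneg_left ?_ (abs_nonneg _))
    refine (norm_inner_le_norm _ _).trans ?_
    have := D.le_opNorm y
    rw [pow_two, mul_left_comm]
    exact mul_le_mul_of_nonneg_left this (norm_nonneg y)
  have h6 : 0 < ‖y‖ ^ 2 := by positivity
  have h7 := abs_nonneg (∑' m, g m * r ^ m)
  nlinarith

end Hilbert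

/-- An isometry `L` of the free semigroup algebra properly factors as soon as the algebra contains
an isometry `X` whose range is orthogonal to that of `L`, both ranges being orthogonal to the
vacuum vector. -/
theorem properlyFactors_of_orthogonal_isometry {L X : toeplitzAlgebra n}
    (hL : ∀ x y, ⟪L.1 x, L.1 y⟫_ℂ = ⟪x, y⟫_ℂ) (hX : ∀ x y, ⟪X.1 x, X.1 y⟫_ℂ = ⟪x, y⟫_ℂ)
    (hXL : ∀ x y, ⟪X.1 x, L.1 y⟫_ℂ = 0) (hL1 : ∀ x, ⟪xi 1, L.1 x⟫_ℂ = 0)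
    (hX1 : ∀ x, ⟪xi 1, X.1 x⟫_ℂ = 0) : ProperlyFactors L := by
  have hF := (summable_smul_pow (X := X.1) (g := fun m => (recipCoeff m : ℂ)) hX
    (by simpa using summable_abs_recipCoeff)).hasSum
  have hC := (summable_smul_pow_mul (X := X.1) (L := L.1) (c := fun m => ((1 / (m + 1) : ℝ) : ℂ))
    hX hL hXL (by
      refine summable_inv_succ_sq.congr fun m => ?_
      rw [Complex.norm_real, Real.norm_eq_abs, sq_abs])).hasSum
  set F := ∑' m, (recipCoeff m : ℂ) • X.1 ^ m
  set C := ∑' m : ℕ, ((1 / (m + 1) : ℝ) : ℂ) • (X.1 ^ m * L.1)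
  have hFmem : F ∈ toeplitzAlgebra n := mem_toeplitzAlgebra_of_hasSum
    (fun m => Subalgebra.smul_mem _ (pow_mem X.2 m) _) hF
  have hCmem : C ∈ toeplitzAlgebra n := mem_toeplitzAlgebra_of_hasSum
    (fun m => Subalgebra.smul_mem _ (mul_mem (pow_mem X.2 m) L.2) _) hC
  have hFC : F * C = L.1 := mul_eq_of_hasSum hX hXL (fun m => by
    have := congrArg (fun t : ℝ => (t : ℂ)) (sum_range_recipCoeff m)
    push_cast at this ⊢
    rw [this]
    split_ifs <;> simp) hF hC
  have hne : (xi 1 : Fock n) ≠ 0 := by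
    rw [← norm_ne_zero_iff, norm_xi]
    exact one_ne_zero
  refine ⟨⟨F, hFmem⟩, ⟨C, hCmem⟩, Subtype.ext hFC.symm, fun h => ?_, fun h => ?_⟩
  · obtain ⟨D, hD⟩ := h.exists_right_inv
    exact not_exists_mul_eq_one hX hne hX1 (fun K hK => exists_abs_tsum_recipCoeff_lt hK) hF
      (congrArg Subtype.val hD)
  · obtain ⟨D, hD⟩ := h.exists_right_inv
    have hD' : C * D.1 = 1 := congrArg Subtype.val hD
    -- The term `m = 0` has range inside that of `L`, the others inside that of `X`. Hence `C`
    -- cannot reach the vacuum.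
    have hC1 : ∀ x, ⟪xi 1, C x⟫_ℂ = 0 := fun x => by
      have h := (hC.mapL (ContinuousLinearMap.apply ℂ (Fock n) x)).mapL (innerSL ℂ (xi 1))
      refine h.unique ?_
      convert hasSum_zero using 2 with m
      rcases m with _ | m
      · simp [hL1]
      · simp [pow_succ', hX1]
    have h1 := hC1 (D.1 (xi 1))
    rw [← mul_apply_eq_comp, hD', one_apply_eq_self] at h1
    exact hne (inner_self_eq_zero.1 h1)

/-! ### Fejér means and a membership criterion -/

theorem norm_sum_smul_xi_sq (s : Finset (FreeMonoid (Fin n))) (c : FreeMonoid (Fin n) → ℂ) :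
    ‖∑ v ∈ s, c v • (xi v : Fock n)‖ ^ 2 = ∑ v ∈ s, ‖c v‖ ^ 2 := by
  have := orthonormal_xi.orthogonalFamily.norm_sum c s
  simpa using this

/-- Boundedly many functionals converging on the standard basis converge pointwise. -/
theorem tendsto_apply_of_tendsto_xi {f : ℕ → Fock n →L[ℂ] ℂ} {g : Fock n →L[ℂ] ℂ} {K : ℝ}
    (hf : ∀ k, ‖f k‖ ≤ K) (h : ∀ v, Tendsto (fun k => f k (xi v)) atTop (𝓝 (g (xi v))))
    (x : Fock n) : Tendsto (fun k => f k x) atTop (𝓝 (g x)) := by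
  have hK : 0 ≤ K := (norm_nonneg _).trans (hf 0)
  have heq : Equicontinuous fun k => (f k : Fock n → ℂ) :=
    (LipschitzWith.uniformEquicontinuous _ K.toNNReal fun k =>
      (f k).lipschitz.weaken (by
        rw [← NNReal.coe_le_coe, coe_nnnorm, Real.coe_toNNReal K hK]
        exact hf k)).equicontinuous
  refine (heq.isClosed_setOfPred_tendsto g.continuous).mem_of_tendsto (hasSum_smul_xi x)
    (Eventually.of_forall fun s => ?_)
  change Tendsto (fun k => f k (∑ v ∈ s, x v • xi v)) atTop (𝓝 (g (∑ v ∈ s, x v • xi v)))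
  simp only [map_sum, map_smul]
  exact tendsto_finsetSum _ fun v _ => (h v).const_smul _

/-- The indicator of the words whose length lies in the window `(p - k, p]`. -/
noncomputable def window (k p : ℕ) (v : FreeMonoid (Fin n)) : ℂ :=
  if v.length ≤ p ∧ p < v.length + k then 1 else 0

/-- A word `u` is seen by the `k` windows `p ∈ [|u|, |u| + k)`, and the sum counts the overlap of
two such intervals. Truncated subtraction gives `0` when they are disjoint. -/
theorem sum_window_mul_window {k N : ℕ} {u v : FreeMonoid (Fin n)} (hu : u.length + k ≤ N) :
    ∑ p ∈ Finset.range N, window k p u * window k p v =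
      ((min u.length v.length + k - max u.length v.length : ℕ) : ℂ) := by
  have : ∀ p, window k p u * window k p v =
      if p ∈ Finset.Ico (max u.length v.length) (min u.length v.length + k) then 1 else 0 := by
    intro p
    simp only [window, Finset.mem_Ico]
    split_ifs <;> first | omega | simp
  simp only [this]
  rw [Finset.sum_boole, Finset.filter_mem_eq_inter, Finset.inter_eq_right.2, Nat.card_Ico]
  intro p hp
  rw [Finset.mem_Ico] at hp
  rw [Finset.mem_range]
  omega

theorem sum_norm_window_sq {k N : ℕ} {v : FreeMonoid (Fin n)} (hv : v.length + k ≤ N) :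
    ∑ p ∈ Finset.range N, ‖window k p v‖ ^ 2 = k := by
  have : ∀ p, ‖window k p v‖ ^ 2 =
      if p ∈ Finset.Ico v.length (v.length + k) then 1 else 0 := by
    intro p
    simp only [window, Finset.mem_Ico]
    split_ifs <;> simp
  simp only [this]
  rw [Finset.sum_boole, Finset.filter_mem_eq_inter, Finset.inter_eq_right.2, Nat.card_Ico,
    Nat.add_sub_cancel_left]
  intro p hp
  rw [Finset.mem_Ico] at hp
  rw [Finset.mem_range]
  omega

theorem sum_norm_window_smul_sq {k N : ℕ} {s : Finset (FreeMonoid (Fin n))}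
    (hs : ∀ v ∈ s, v.length + k ≤ N) (c : FreeMonoid (Fin n) → ℂ) :
    ∑ p ∈ Finset.range N, ‖∑ v ∈ s, (window k p v * c v) • (xi v : Fock n)‖ ^ 2 =
      k * ‖∑ v ∈ s, c v • (xi v : Fock n)‖ ^ 2 := by
  simp only [norm_sum_smul_xi_sq]
  rw [Finset.sum_comm, Finset.mul_sum]
  refine Finset.sum_congr rfl fun v hv => ?_
  simp only [norm_mul, mul_pow]
  rw [← Finset.sum_mul, sum_norm_window_sq (hs v hv)]

/-- The Fejér multiplier, acting on matrices graded by word length, is contractive. -/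
theorem norm_le_of_fejer_multiplier {k : ℕ} (hk : 0 < k) {S T : Fock n →L[ℂ] Fock n}
    (h : ∀ u v : FreeMonoid (Fin n), (k : ℂ) * ⟪xi u, S (xi v)⟫_ℂ =
      ((min u.length v.length + k - max u.length v.length : ℕ) : ℂ) * ⟪xi u, T (xi v)⟫_ℂ) :
    ‖S‖ ≤ ‖T‖ := by
  have hkR : (0 : ℝ) < k := by exact_mod_cast hk
  have hfin : ∀ (s : Finset (FreeMonoid (Fin n))) (x y : FreeMonoid (Fin n) → ℂ),
      ‖⟪∑ u ∈ s, y u • xi u, S (∑ v ∈ s, x v • xi v)⟫_ℂ‖ ≤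
        ‖T‖ * (‖∑ u ∈ s, y u • (xi u : Fock n)‖ * ‖∑ v ∈ s, x v • (xi v : Fock n)‖) := by
    intro s x y
    set N := s.sup (fun v => v.length + k) with hN
    have hs : ∀ v ∈ s, v.length + k ≤ N := fun v hv =>
      Finset.le_sup (f := fun v : FreeMonoid (Fin n) => v.length + k) hv
    set X : ℕ → Fock n := fun p => ∑ v ∈ s, (window k p v * x v) • xi v with hX
    set Y : ℕ → Fock n := fun p => ∑ u ∈ s, (window k p u * y u) • xi u with hY
    -- The multiplier is `1/k` times the sum of the compressions of `T` to the windows.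
    have hsum : (k : ℂ) * ⟪∑ u ∈ s, y u • xi u, S (∑ v ∈ s, x v • xi v)⟫_ℂ =
        ∑ p ∈ Finset.range N, ⟪Y p, T (X p)⟫_ℂ := by
      simp only [hX, hY, map_sum, map_smul, sum_inner, inner_sum, inner_smul_left,
        inner_smul_right, Finset.mul_sum]
      rw [Finset.sum_comm (s := Finset.range N)]
      refine Finset.sum_congr rfl fun v hv => ?_
      rw [Finset.sum_comm (s := Finset.range N)]
      refine Finset.sum_congr rfl fun u hu => ?_
      have hconj : ∀ p, conj (window k p u) = window k p u := fun p => by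
        rw [window]; split_ifs <;> simp
      simp only [map_mul, hconj]
      calc _ = conj (y u) * x v * ((k : ℂ) * ⟪xi u, S (xi v)⟫_ℂ) := by ring
        _ = _ := by
          rw [h, ← sum_window_mul_window (hs u hu), Finset.sum_mul, Finset.mul_sum]
          refine Finset.sum_congr rfl fun p _ => ?_
          ring
    have hle : (k : ℝ) * ‖⟪∑ u ∈ s, y u • xi u, S (∑ v ∈ s, x v • xi v)⟫_ℂ‖ ≤
        ∑ p ∈ Finset.range N, ‖T‖ * (‖Y p‖ * ‖X p‖) := by
      have := congrArg norm hsum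
      rw [norm_mul, Complex.norm_natCast] at this
      rw [this]
      refine (norm_sum_le _ _).trans (Finset.sum_le_sum fun p _ => ?_)
      refine (norm_inner_le_norm _ _).trans ?_
      rw [mul_left_comm]
      exact mul_le_mul_of_nonneg_left (T.le_opNorm _) (norm_nonneg _)
    rw [← Finset.mul_sum] at hle
    -- Each word is seen by exactly `k` windows, so Cauchy–Schwarz over `p` yields one factor `k`,
    -- which cancels the one on the left.
    have hcs := Real.sum_mul_le_sqrt_mul_sqrt (Finset.range N) (fun p => ‖Y p‖) fun p => ‖X p‖
    rw [sum_norm_window_smul_sq hs y, sum_norm_window_smul_sq hs x, Real.sqrt_mul hkR.le,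
      Real.sqrt_mul hkR.le, Real.sqrt_sq (norm_nonneg _), Real.sqrt_sq (norm_nonneg _),
      mul_mul_mul_comm, Real.mul_self_sqrt hkR.le] at hcs
    have := hle.trans (mul_le_mul_of_nonneg_left hcs (norm_nonneg T))
    rw [mul_left_comm] at this
    exact le_of_mul_le_mul_left this hkR
  refine ContinuousLinearMap.opNorm_le_bound _ (norm_nonneg _) fun x => ?_
  have hb : ∀ y, ‖⟪y, S x⟫_ℂ‖ ≤ ‖T‖ * (‖y‖ * ‖x‖) := fun y => by
    have hx := hasSum_smul_xi x
    have hy := hasSum_smul_xi y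
    have hSx := (S.continuous.tendsto x).comp hx
    exact le_of_tendsto_of_tendsto (hy.inner hSx).norm
      ((hy.norm.mul hx.norm).const_mul ‖T‖) (Eventually.of_forall fun s => hfin s x y)
  have h1 := hb (S x)
  rcases eq_or_ne (S x) 0 with h0 | h0
  · rw [h0, norm_zero]
    positivity
  rw [inner_self_eq_norm_sq_to_K] at h1
  simp only [Complex.coe_algebraMap, norm_pow, Complex.norm_real, norm_norm] at h1
  rw [pow_two, mul_left_comm] at h1
  exact le_of_mul_le_mul_left h1 (norm_pos_iff.2 h0)

/-- The `k`-th Cesàro mean of the Fourier series `∑ a_w L_w`. -/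
noncomputable def cesaro (a : FreeMonoid (Fin n) → ℂ) (k : ℕ) : Fock n →L[ℂ] Fock n :=
  ∑ w ∈ (Finset.range k).biUnion (words n), (((k - w.length : ℕ) : ℂ) / k * a w) • leftReg w

theorem cesaro_mem (a : FreeMonoid (Fin n) → ℂ) (k : ℕ) : cesaro a k ∈ toeplitzAlgebra n :=
  sum_mem fun w _ => Subalgebra.smul_mem _ (leftReg_mem w) _

theorem inner_xi_cesaro (a : FreeMonoid (Fin n) → ℂ) (k : ℕ) (u v : FreeMonoid (Fin n)) :
    ⟪xi u, cesaro a k (xi v)⟫_ℂ = ∑ w ∈ (Finset.range k).biUnion (words n),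
      if u = w * v then ((k - w.length : ℕ) : ℂ) / k * a w else 0 := by
  simp [cesaro, leftReg_xi, inner_xi, xi_apply]

theorem inner_xi_mul_cesaro (a : FreeMonoid (Fin n) → ℂ) (k : ℕ) (w v : FreeMonoid (Fin n)) :
    ⟪xi (w * v), cesaro a k (xi v)⟫_ℂ = ((k - w.length : ℕ) : ℂ) / k * a w := by
  simp only [inner_xi_cesaro, mul_left_inj]
  rw [Finset.sum_ite_eq]
  split_ifs with hw
  · rfl
  · have : k ≤ w.length := by
      by_contra! hlt
      exact hw (Finset.mem_biUnion.2 ⟨_, Finset.mem_range.2 hlt, mem_words.2 rfl⟩)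
    simp [Nat.sub_eq_zero_of_le this]

theorem inner_xi_cesaro_of_forall_ne (a : FreeMonoid (Fin n) → ℂ) (k : ℕ)
    {u v : FreeMonoid (Fin n)} (h : ∀ w, w * v ≠ u) : ⟪xi u, cesaro a k (xi v)⟫_ℂ = 0 := by
  rw [inner_xi_cesaro]
  exact Finset.sum_eq_zero fun w _ => if_neg (h w).symm

/-- A bounded operator `T` with `T ξ_v = R_v η` for all words `v` belongs to the free semigroup
algebra. -/
theorem mem_toeplitzAlgebra_of_apply_xi {T : Fock n →L[ℂ] Fock n} {η : Fock n}
    (hT : ∀ v, T (xi v) = rightReg v η) : T ∈ toeplitzAlgebra n := by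
  -- The matrix of the Cesàro mean is that of `T` with Fejér weights depending only on word lengths.
  -- The shift to `k + 1` keeps the denominator nonzero.
  have hnorm : ∀ k : ℕ, ‖cesaro η (k + 1)‖ ≤ ‖T‖ := fun k => by
    refine norm_le_of_fejer_multiplier k.succ_pos fun u v => ?_
    rw [hT, inner_xi u (rightReg v η)]
    by_cases h : ∃ w, w * v = u
    · obtain ⟨w, rfl⟩ := h
      have hl : (w * v).length = w.length + v.length := FreeMonoid.length_mul w v
      rw [inner_xi_mul_cesaro, rightReg_apply_mul, hl,
        show min (w.length + v.length) v.length + (k + 1) - max (w.length + v.length) v.length =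
          k + 1 - w.length by omega, ← mul_assoc, mul_div_cancel₀]
      exact_mod_cast k.succ_ne_zero
    · push Not at h
      rw [inner_xi_cesaro_of_forall_ne _ _ h, rightReg_apply_of_forall_ne h, mul_zero, mul_zero]
  have hentry : ∀ u v, Tendsto (fun k : ℕ => ⟪xi u, cesaro η (k + 1) (xi v)⟫_ℂ) atTop
      (𝓝 ⟪xi u, T (xi v)⟫_ℂ) := fun u v => by
    rw [hT, inner_xi u (rightReg v η)]
    by_cases h : ∃ w, w * v = u
    · obtain ⟨w, rfl⟩ := h
      simp only [inner_xi_mul_cesaro, rightReg_apply_mul]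
      have h1 : Tendsto (fun k : ℕ => 1 - (w.length : ℂ) / ((k + 1 : ℕ) : ℂ)) atTop (𝓝 (1 - 0)) :=
        tendsto_const_nhds.sub ((tendsto_add_atTop_iff_nat 1).2
          (tendsto_const_div_atTop_nhds_zero_nat (w.length : ℂ)))
      have h2 : Tendsto (fun k : ℕ => ((k + 1 - w.length : ℕ) : ℂ) / ((k + 1 : ℕ) : ℂ)) atTop
          (𝓝 1) := by
        rw [sub_zero] at h1
        refine h1.congr' ?_
        filter_upwards [eventually_ge_atTop w.length] with k hk
        rw [Nat.cast_sub (by omega), sub_div, div_self]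
        exact_mod_cast k.succ_ne_zero
      simpa using h2.mul_const (η w)
    · push Not at h
      simp only [inner_xi_cesaro_of_forall_ne _ _ h, rightReg_apply_of_forall_ne h]
      exact tendsto_const_nhds
  refine mem_toeplitzAlgebra_of_tendsto_inner (l := atTop) (S := fun k : ℕ => cesaro η (k + 1))
    (fun k => cesaro_mem _ _) fun x y => ?_
  -- Uniform boundedness upgrades entrywise convergence to weak convergence one variable at a time;
  -- conjugation then makes the second variable the linear one.
  have h1 : ∀ u, Tendsto (fun k : ℕ => ⟪xi u, cesaro η (k + 1) x⟫_ℂ) atTop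
      (𝓝 ⟪xi u, T x⟫_ℂ) := fun u =>
    tendsto_apply_of_tendsto_xi (f := fun k => (innerSL ℂ (xi u)).comp (cesaro η (k + 1)))
      (g := (innerSL ℂ (xi u)).comp T) (K := 1 * ‖T‖) (fun k =>
        (ContinuousLinearMap.opNorm_comp_le _ _).trans
          (mul_le_mul (by rw [innerSL_apply_norm, norm_xi]) (hnorm k) (norm_nonneg _) zero_le_one))
      (fun v => hentry u v) x
  have h2 := tendsto_apply_of_tendsto_xi (f := fun k => innerSL ℂ (cesaro η (k + 1) x))
    (g := innerSL ℂ (T x)) (K := ‖T‖ * ‖x‖) (fun k => by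
      rw [innerSL_apply_norm]
      exact ((cesaro η (k + 1)).le_opNorm x).trans
        (mul_le_mul_of_nonneg_right (hnorm k) (norm_nonneg _)))
    (fun u => by simpa [Function.comp_def] using (Complex.continuous_conj.tendsto _).comp (h1 u)) y
  simpa [Function.comp_def] using (Complex.continuous_conj.tendsto _).comp h2

/-- The closure of the range of a nonzero element `B` of the free semigroup algebra contains the
range of an isometry in the algebra. -/
theorem exists_isometry_of_ne_zero {B : Fock n →L[ℂ] Fock n} (hB : B ∈ toeplitzAlgebra n)
    (hB0 : B ≠ 0) : ∃ V ∈ toeplitzAlgebra n, (∀ x y, ⟪V x, V y⟫_ℂ = ⟪x, y⟫_ℂ) ∧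
      ∀ x, V x ∈ B.range.topologicalClosure := by
  set M : Submodule ℂ (Fock n) := B.range.topologicalClosure with hM
  have hMcl : IsClosed (M : Set (Fock n)) := Submodule.isClosed_topologicalClosure _
  have : CompleteSpace M := hMcl.completeSpace_coe
  -- `B` commutes with `R_v`, so its range, and then the closure, is invariant under `R_v`.
  have hinv : ∀ v, ∀ m ∈ M, rightReg v m ∈ M := fun v => by
    have : M ≤ M.comap (rightReg v).toLinearMap := by
      refine Submodule.topologicalClosure_minimal _ ?_ (hMcl.preimage (rightReg v).continuous)
      rintro _ ⟨x, rfl⟩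
      refine Submodule.le_topologicalClosure _ ⟨rightReg v x, ?_⟩
      exact DFunLike.congr_fun (commute_rightReg hB v) x
    exact this
  have hex : ∃ d, ∃ w : FreeMonoid (Fin n), w.length = d ∧ ∃ m ∈ M, m w ≠ 0 := by
    by_contra! hcon
    refine hB0 (ContinuousLinearMap.ext fun x => ?_)
    ext w
    exact hcon _ w rfl (B x) (Submodule.le_topologicalClosure _ ⟨x, rfl⟩)
  classical
  obtain ⟨w, hwd, m₀, hm₀, hm₀w⟩ := Nat.find_spec hex
  have hmin : ∀ u : FreeMonoid (Fin n), u.length < w.length → ∀ m ∈ M, m u = 0 := by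
    intro u hu m hm
    by_contra hne
    exact Nat.find_min hex (hwd ▸ hu) ⟨u, rfl, m, hm, hne⟩
  -- With `w` of minimal length among words carrying a nonzero coefficient of some element of `M`,
  -- the vector `ζ` represents the coefficient at `w` on `M`. It is a wandering vector for the right
  -- regular representation.
  set ζ : Fock n := M.starProjection (xi w) with hζ
  have hζM : ζ ∈ M := M.starProjection_apply_mem _
  have hζm : ∀ m ∈ M, ⟪ζ, m⟫_ℂ = m w := fun m hm => by
    rw [← inner_xi, hζ, Submodule.inner_starProjection_left_eq_right,
      Submodule.starProjection_eq_self_iff.2 hm]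
  have hζ0 : ζ ≠ 0 := fun h => hm₀w (by rw [← hζm m₀ hm₀, h, inner_zero_left])
  -- The coefficient of `R_v ζ` at `w` is either zero or a coefficient of `ζ` at a strictly shorter
  -- word, which vanishes by minimality.
  have hζR : ∀ v ≠ 1, ⟪ζ, rightReg v ζ⟫_ℂ = 0 := fun v hv => by
    rw [hζm _ (hinv v _ hζM)]
    by_cases h : ∃ u, u * v = w
    · obtain ⟨u, rfl⟩ := h
      rw [rightReg_apply_mul]
      refine hmin u ?_ ζ hζM
      have : (u * v).length = u.length + v.length := FreeMonoid.length_mul u v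
      have : v.length ≠ 0 := fun h => hv (FreeMonoid.length_eq_zero.1 h)
      omega
    · push Not at h
      exact rightReg_apply_of_forall_ne h _
  set η : Fock n := ((‖ζ‖⁻¹ : ℝ) : ℂ) • ζ with hη
  have hηM : η ∈ M := M.smul_mem _ hζM
  have hηn : ‖η‖ = 1 := by
    rw [hη, norm_smul, Complex.norm_real, norm_inv, norm_norm,
      inv_mul_cancel₀ (norm_ne_zero_iff.2 hζ0)]
  have hηR : ∀ v ≠ 1, ⟪η, rightReg v η⟫_ℂ = 0 := fun v hv => by
    simp [hη, hζR v hv]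
  have hsuff : ∀ u v : FreeMonoid (Fin n), u ≠ v → (∃ t, t * u = v) →
      ⟪rightReg u η, rightReg v η⟫_ℂ = 0 := by
    rintro u _ hne ⟨t, rfl⟩
    rw [rightReg_mul, mul_apply_eq_comp, inner_rightReg_rightReg]
    exact hηR t fun h => hne (by rw [h, one_mul])
  have horth : Orthonormal ℂ fun v : FreeMonoid (Fin n) => rightReg v η := by
    refine ⟨fun v => ?_, fun u v huv => ?_⟩
    · rw [norm_map_of_inner_map_map (inner_rightReg_rightReg v), hηn]
    · change ⟪rightReg u η, rightReg v η⟫_ℂ = 0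
      by_cases h1 : ∃ t, t * u = v
      · exact hsuff u v huv h1
      by_cases h2 : ∃ t, t * v = u
      · rw [← inner_conj_symm, hsuff v u huv.symm h2, map_zero]
      -- When neither word is a suffix of the other, `R_u` and `R_v` have orthogonal ranges: two
      -- suffixes of one word are always comparable.
      have h3 : ∀ x, ⟪xi (x * u), rightReg v η⟫_ℂ = 0 := fun x => by
        rw [inner_xi]
        refine rightReg_apply_of_forall_ne (fun y hy => ?_) η
        have hy' : y.toList ++ v.toList = x.toList ++ u.toList := congrArg FreeMonoid.toList hy
        rcases List.suffix_or_suffix_of_suffix ⟨_, hy'⟩ (List.suffix_append _ _) with h | h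
        · obtain ⟨t, ht⟩ := h
          exact h2 ⟨FreeMonoid.ofList t, ht⟩
        · obtain ⟨t, ht⟩ := h
          exact h1 ⟨FreeMonoid.ofList t, ht⟩
      have h4 : (innerSL ℂ (rightReg v η)).comp (rightReg u) = 0 := clm_ext_xi fun x => by
        simp only [ContinuousLinearMap.comp_apply, innerSL_apply_apply, rightReg_xi, zero_apply]
        rw [← inner_conj_symm, h3, map_zero]
      rw [← inner_conj_symm]
      have h5 : ⟪rightReg v η, rightReg u η⟫_ℂ = 0 := DFunLike.congr_fun h4 η
      rw [h5, map_zero]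
  set V := (isometryOfOrthonormal horth).toContinuousLinearMap with hV
  have hVxi : ∀ v, V (xi v) = rightReg v η := isometryOfOrthonormal_xi horth
  refine ⟨V, mem_toeplitzAlgebra_of_apply_xi hVxi, (isometryOfOrthonormal horth).inner_map_map,
    fun x => ?_⟩
  refine hMcl.mem_of_tendsto ((hasSum_smul_xi x).mapL V) (Eventually.of_forall fun s => ?_)
  refine M.sum_mem fun v _ => ?_
  rw [map_smul, hVxi]
  exact M.smul_mem _ (hinv v _ hηM)

/-! ### Constructing the orthogonal isometry from the coefficients of `L` -/

variable {k : ℕ}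

/-- Orthogonality of the ranges of the `L_v` with `|v| = k` leaves only the term at `w`: this is
`L_w* L = A_w`. -/
theorem inner_leftReg_sum {L : Fock n →L[ℂ] Fock n} {A : FreeMonoid (Fin n) → Fock n →L[ℂ] Fock n}
    (hLA : L = ∑ w ∈ words n k, leftReg w * A w) {w : FreeMonoid (Fin n)} (hw : w ∈ words n k)
    (x y : Fock n) : ⟪leftReg w x, L y⟫_ℂ = ⟪x, A w y⟫_ℂ := by
  rw [hLA, sum_apply, inner_sum, Finset.sum_eq_single_of_mem w hw]
  · rw [mul_apply_eq_comp, inner_leftReg_leftReg]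
  · intro v hv hne
    exact inner_leftReg_leftReg_of_ne ((mem_words.1 hw).trans (mem_words.1 hv).symm) hne.symm _ _

theorem ne_one_of_mem_words (hk : 1 ≤ k) {w : FreeMonoid (Fin n)} (hw : w ∈ words n k) :
    w ≠ 1 := by
  rintro rfl
  have : (1 : FreeMonoid (Fin n)).length = k := mem_words.1 hw
  rw [FreeMonoid.length_one] at this
  omega

theorem exists_mem_words_ne (hn : 2 ≤ n) (hk : 1 ≤ k) (w : FreeMonoid (Fin n)) :
    ∃ u ∈ words n k, u ≠ w := by
  have hlen : ∀ i : Fin n, FreeMonoid.ofList (List.replicate k i) ∈ words n k := fun i =>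
    mem_words.2 List.length_replicate
  by_contra! h
  have h01 := (h _ (hlen ⟨0, by omega⟩)).trans (h _ (hlen ⟨1, by omega⟩)).symm
  have := (List.replicate_right_inj (by omega)).1 (FreeMonoid.ofList.injective h01)
  simp at this

variable {L : toeplitzAlgebra n} {A : FreeMonoid (Fin n) → toeplitzAlgebra n}

theorem inner_xi_one_sum_leftReg (hk : 1 ≤ k)
    (hLA : L.1 = ∑ w ∈ words n k, leftReg w * (A w).1) (x : Fock n) :
    ⟪xi 1, L.1 x⟫_ℂ = 0 := by
  rw [hLA, sum_apply, inner_sum]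
  exact Finset.sum_eq_zero fun w hw => inner_xi_one_leftReg (ne_one_of_mem_words hk hw) _

/-- The isometry is `X = L_w V`, with `V` taken from the closure of the range of `B`: `⟪L_w V x, L
y⟫ = ⟪V x, A_w y⟫ = 0`. -/
theorem properlyFactors_of_orthogonal_range (hk : 1 ≤ k) (hL : Isometry L.1)
    (hLA : L.1 = ∑ w ∈ words n k, leftReg w * (A w).1) {w : FreeMonoid (Fin n)}
    (hw : w ∈ words n k) {B : toeplitzAlgebra n} (hB : B ≠ 0)
    (hBA : ∀ x y, ⟪B.1 x, (A w).1 y⟫_ℂ = 0) : ProperlyFactors L := by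
  obtain ⟨V, hV, hViso, hVB⟩ := exists_isometry_of_ne_zero B.2 fun h => hB (Subtype.ext h)
  have hVA : ∀ x y, ⟪V x, (A w).1 y⟫_ℂ = 0 := fun x y => by
    have : B.1.range.topologicalClosure ≤ (ℂ ∙ (A w).1 y)ᗮ := by
      refine Submodule.topologicalClosure_minimal _ ?_ (Submodule.isClosed_orthogonal _)
      rintro _ ⟨z, rfl⟩
      rw [Submodule.mem_orthogonal_singleton_iff_inner_left]
      exact hBA z y
    exact Submodule.mem_orthogonal_singleton_iff_inner_left.1 (this (hVB x))
  refine properlyFactors_of_orthogonal_isometry (X := ⟨leftReg w * V, mul_mem (leftReg_mem w) hV⟩)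
    (inner_map_map_of_isometry hL) (fun x y => ?_) (fun x y => ?_)
    (inner_xi_one_sum_leftReg hk hLA)
    fun x => inner_xi_one_leftReg (ne_one_of_mem_words hk hw) (V x)
  · simp only [mul_apply_eq_comp, inner_leftReg_leftReg, hViso]
  · simp only [mul_apply_eq_comp, inner_leftReg_sum (A := fun w => (A w).1) hLA hw, hVA]

/-- Here `X = L_w` already works. -/
theorem properlyFactors_of_eq_zero (hk : 1 ≤ k) (hL : Isometry L.1)
    (hLA : L.1 = ∑ w ∈ words n k, leftReg w * (A w).1) {w : FreeMonoid (Fin n)}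
    (hw : w ∈ words n k) (hA : A w = 0) : ProperlyFactors L := by
  refine properlyFactors_of_orthogonal_isometry (X := ⟨leftReg w, leftReg_mem w⟩)
    (inner_map_map_of_isometry hL) (inner_leftReg_leftReg w) (fun x y => ?_)
    (inner_xi_one_sum_leftReg hk hLA)
    fun x => inner_xi_one_leftReg (ne_one_of_mem_words hk hw) x
  rw [inner_leftReg_sum (A := fun w => (A w).1) hLA hw, hA]
  simp

theorem properlyFactors_of_smul_isometry (hn : 2 ≤ n) (hk : 1 ≤ k) (hL : Isometry L.1)
    (hLA : L.1 = ∑ w ∈ words n k, leftReg w * (A w).1) {w : FreeMonoid (Fin n)}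
    (hw : w ∈ words n k) {c : ℂ} {V : Fock n →L[ℂ] Fock n} (hV : Isometry V)
    (hA : (A w).1 = c • V) : ProperlyFactors L := by
  have hLi := inner_map_map_of_isometry hL
  set a : ℝ := ‖c‖ ^ 2 with ha
  have hAA : ∀ x y, ⟪(A w).1 x, (A w).1 y⟫_ℂ = a * ⟪x, y⟫_ℂ := fun x y => by
    rw [hA, smul_apply, smul_apply, inner_smul_left, inner_smul_right,
      inner_map_map_of_isometry hV, ← mul_assoc, Complex.conj_mul', ha]
    push_cast
    rfl
  rcases eq_or_ne c 0 with rfl | hc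
  · exact properlyFactors_of_eq_zero hk hL hLA hw (Subtype.ext (by simpa using hA))
  have ha0 : 0 < a := by positivity
  -- Since `L` is isometric, the column of coefficients `A_v` is isometric too.
  have hsum : ∀ x, ∑ v ∈ words n k, ‖(A v).1 x‖ ^ 2 = ‖x‖ ^ 2 := fun x => by
    have h : ((∑ v ∈ words n k, ‖(A v).1 x‖ ^ 2 : ℝ) : ℂ) = ((‖x‖ ^ 2 : ℝ) : ℂ) := by
      push_cast
      have h1 : ∀ z : Fock n, (‖z‖ : ℂ) ^ 2 = ⟪z, z⟫_ℂ := fun z =>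
        (inner_self_eq_norm_sq_to_K z).symm
      simp only [h1]
      rw [← hLi, show ⟪L.1 x, L.1 x⟫_ℂ = ∑ v ∈ words n k, ⟪(leftReg v * (A v).1) x, L.1 x⟫_ℂ by
        rw [← sum_inner, ← sum_apply, ← hLA]]
      refine Finset.sum_congr rfl fun v hv => ?_
      rw [mul_apply_eq_comp, inner_leftReg_sum (A := fun w => (A w).1) hLA hv]
    exact_mod_cast h
  have hAw : ∀ x, ‖(A w).1 x‖ ^ 2 = a * ‖x‖ ^ 2 := fun x => by
    rw [hA, smul_apply, norm_smul, mul_pow,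
      norm_map_of_inner_map_map (inner_map_map_of_isometry hV)]
  have hxi : ‖(xi 1 : Fock n)‖ ^ 2 = 1 := by rw [norm_xi, one_pow]
  have ha1 : a ≤ 1 := by
    have h := hsum (xi 1)
    have h2 := Finset.single_le_sum (f := fun v => ‖(A v).1 (xi 1)‖ ^ 2)
      (fun v _ => by positivity) hw
    rw [h] at h2
    simpa only [hAw, hxi, mul_one] using h2
  -- If `a = 1`, then `A_w` exhausts the norm and every other coefficient vanishes; `n ≥ 2` supplies
  -- another word.
  rcases ha1.eq_or_lt with ha1 | ha1
  · obtain ⟨u, hu, huw⟩ := exists_mem_words_ne hn hk w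
    refine properlyFactors_of_eq_zero hk hL hLA hu
      (Subtype.ext (ContinuousLinearMap.ext fun x => ?_))
    have h := hsum x
    rw [← Finset.add_sum_erase _ _ hw, hAw, ha1, one_mul, add_eq_left] at h
    have h2 := (Finset.sum_eq_zero_iff_of_nonneg fun v _ => by positivity).1 h u
      (Finset.mem_erase.2 ⟨huw, hu⟩)
    simpa using h2
  set P : Fock n →L[ℂ] Fock n := leftReg w * (A w).1 with hP
  have hPL : ∀ x y, ⟪P x, L.1 y⟫_ℂ = a * ⟪x, y⟫_ℂ := fun x y => by
    rw [hP, mul_apply_eq_comp, inner_leftReg_sum (A := fun w => (A w).1) hLA hw, hAA]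
  have hLP : ∀ x y, ⟪L.1 x, P y⟫_ℂ = a * ⟪x, y⟫_ℂ := fun x y => by
    rw [← inner_conj_symm, hPL, map_mul, Complex.conj_ofReal, inner_conj_symm]
  have hPP : ∀ x y, ⟪P x, P y⟫_ℂ = a * ⟪x, y⟫_ℂ := fun x y => by
    rw [hP, mul_apply_eq_comp, mul_apply_eq_comp, inner_leftReg_leftReg, hAA]
  have hPmem : P ∈ toeplitzAlgebra n := mul_mem (leftReg_mem w) (A w).2
  have haC : (a : ℂ) ≠ 0 := by exact_mod_cast ha0.ne'
  have hs2 : 0 < a⁻¹ - 1 := by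
    rw [sub_pos]
    exact (one_lt_inv₀ ha0).2 ha1
  set s : ℝ := √(a⁻¹ - 1) with hs
  have hsC : (s : ℂ) * s = (a : ℂ)⁻¹ - 1 := by
    have := Real.mul_self_sqrt hs2.le
    exact_mod_cast this
  have hs0 : (s : ℂ) ≠ 0 := by exact_mod_cast (Real.sqrt_pos.2 hs2).ne'
  -- From `P*L = P*P = a` it follows that `L - a⁻¹P` has range orthogonal to that of `L` and is
  -- `√(a⁻¹ - 1)` times an isometry, whence the normalisation by `s`.
  set X : Fock n →L[ℂ] Fock n := ((s⁻¹ : ℝ) : ℂ) • (L.1 - ((a⁻¹ : ℝ) : ℂ) • P) with hX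
  have hXmem : X ∈ toeplitzAlgebra n :=
    Subalgebra.smul_mem _ (sub_mem L.2 (Subalgebra.smul_mem _ hPmem _)) _
  refine properlyFactors_of_orthogonal_isometry (X := ⟨X, hXmem⟩) hLi (fun x y => ?_)
    (fun x y => ?_) (inner_xi_one_sum_leftReg hk hLA) fun x => ?_
  · simp only [hX, smul_apply, sub_apply, inner_smul_left, inner_smul_right, inner_sub_left,
      inner_sub_right, hPL, hLP, hPP, hLi, Complex.conj_ofReal]
    push_cast
    field_simp
    rw [pow_two, hsC]
    field_simp
    ring
  · simp only [hX, smul_apply, sub_apply, inner_smul_left, inner_sub_left,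
      hPL, hLi, Complex.conj_ofReal]
    push_cast
    field_simp
    ring
  · have h1 : ⟪xi 1, P x⟫_ℂ = 0 := inner_xi_one_leftReg (ne_one_of_mem_words hk hw) _
    simp only [hX, smul_apply, sub_apply, inner_smul_right, inner_sub_right, h1,
      inner_xi_one_sum_leftReg hk hLA, mul_zero, sub_zero]

end FreeSemigroupAlgebra

open FreeSemigroupAlgebra in
theorem corollary2p9 (n k : ℕ) (hk : 1 ≤ k)
    (L : toeplitzAlgebra n) (hL : Isometry (L : Fock n →L[ℂ] Fock n))
    (A : FreeMonoid (Fin n) → toeplitzAlgebra n)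
    (hLA : (L : Fock n →L[ℂ] Fock n) =
      ∑ w ∈ words n k, leftReg w * (A w : Fock n →L[ℂ] Fock n)) :
    ((∃ w ∈ words n k, ∃ B : toeplitzAlgebra n, B ≠ 0 ∧
        ∀ ξ η : Fock n, ⟪(B : Fock n →L[ℂ] Fock n) ξ, (A w : Fock n →L[ℂ] Fock n) η⟫_ℂ = 0) →
      ProperlyFactors L) ∧
    (2 ≤ n →
      (∃ w ∈ words n k, ∃ (c : ℂ) (V : Fock n →L[ℂ] Fock n), Isometry V ∧
        (A w : Fock n →L[ℂ] Fock n) = c • V) →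
      ProperlyFactors L) ∧
    ((∃ w ∈ words n k, A w = 0) → ProperlyFactors L) := by
  refine ⟨?_, ?_, ?_⟩
  · rintro ⟨w, hw, B, hB, hBA⟩
    exact properlyFactors_of_orthogonal_range hk hL hLA hw hB hBA
  · rintro hn ⟨w, hw, c, V, hV, hA⟩
    exact properlyFactors_of_smul_isometry hn hk hL hLA hw hV hA
  · rintro ⟨w, hw, hA⟩
    exact properlyFactors_of_eq_zero hk hL hLA hw hA
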